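/- **Definitions.** A probability measure $\rho$ on $\mathbb R$ is *geometrically infinitely divisible (GID)* if for each $p\in(0,1)$ there are an iid sequence $X_1,X_2,\dots$ of real random variables and a random variable $G$ independent of this sequence, with $\mathbb P(G=k)=p(1-p)^{k-1}$ for $k=1,2,\dots$, such that $X_1+\dots+X_G$ has law $\rho$; a measure on $[0,\infty)$ is regarded as a measure on $\mathbb R$. For $a_n\in(0,1)$ and an array $(\pi^m_n)_{m\ge 1}$ of probability measures on $[0,\infty)$ put $$\rho_n=\sum_{k=0}^\infty (1-a_n)\,a_n^k\;\pi^1_n*\dots*\pi^k_n ,$$ where the $k=0$ convolution is $\delta_0$. For probability measures $\nu_1,\nu_2$ on $[0,\infty)$ put $W^1_{[0,T]}(\nu_1,\nu_2)=\int_0^T|\nu_1([0,t])-\nu_2([0,t])|\,dt$. The array satisfies the *conditions of the convergence theorem* (for nonhomogeneous Hawkes processes) if 1. $\pi^m_n(\{0\})=0$ for all $m,n$; 2. it is null: $\lim_n\sup_m\pi^m_n([\varepsilon,\infty))=0$ for each $\varepsilon>0$; 3. $\rho_n$ converges weakly to some probability measure on $[0,\infty)$ that has no atom at $0$; 4. either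 there is an integer $d\ge1$ with $\pi^{m+d}_n=\pi^m_n$ for all $m,n$, or $\lim_n(1-a_n)^{-2}\sup_m W^1_{[0,T]}(\pi^m_n,\pi^1_n)=0$ for each $T\ge0$. (The remaining hypothesis of that theorem concerns only the background intensities, not the array.) **Proposition.** Let $\rho$ be a GID probability measure on $[0,\infty)$ with $\rho(\{0\})=0$, and let $(a_n)$ be a sequence in $(0,1)$ with $a_n\to1$. Then there is a sequence $(\pi_n)$ of probability measures on $[0,\infty)$ such that the row-constant array $\pi^m_n=\pi_n$ satisfies the conditions of the convergence theorem and $\rho_n\to\rho$ weakly. -/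

import Mathlib

open Filter Topology MeasureTheory ProbabilityTheory
open scoped NNReal ENNReal

/-- A probability law `ρ` on the real line is *geometrically infinitely divisible* if for each
`p ∈ (0,1)` there are an iid sequence `X₁, X₂, …` of real random variables and an independent
geometric random variable `G` with values in `{1, 2, …}` and success probability `p`
(so `P(G = k) = p (1-p)^(k-1)` for `k ≥ 1`) such that `X₁ + ⋯ + X_G` has law `ρ`.
In the code `X m` stands for `X_{m+1}`. -/
def IsGeomInfDivisible (ρ : Measure ℝ) : Prop :=
  ∀ p ∈ Set.Ioo (0 : ℝ) 1,
    ∃ (Ω : Type) (_ : MeasurableSpace Ω) (P : Measure Ω) (X : ℕ → Ω → ℝ) (G : Ω → ℕ),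
      IsProbabilityMeasure P ∧
      (∀ m, Measurable (X m)) ∧ Measurable G ∧
      iIndepFun X P ∧
      (∀ m, IdentDistrib (X m) (X 0) P P) ∧
      (∀ k : ℕ, P (G ⁻¹' {k + 1}) = ENNReal.ofReal (p * (1 - p) ^ k)) ∧
      IndepFun G (fun ω m => X m ω) P ∧
      P.map (fun ω => ∑ m ∈ Finset.range (G ω), X m ω) = ρ

/-- The convolution `π^1 * ⋯ * π^k` (the Dirac mass at `0` if `k = 0`) of the first `k` terms of a
sequence of probability measures on `[0,∞)`. In the code `π m` stands for `π^{m+1}`. -/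
noncomputable def convFirst (π : ℕ → ProbabilityMeasure ℝ≥0) : ℕ → Measure ℝ≥0
  | 0 => Measure.dirac 0
  | k + 1 => (convFirst π k).conv (π k : Measure ℝ≥0)

instance isProbabilityMeasure_convFirst (π : ℕ → ProbabilityMeasure ℝ≥0) (k : ℕ) :
    IsProbabilityMeasure (convFirst π k) := by
  induction k with
  | zero => unfold convFirst; infer_instance
  | succ k ih => unfold convFirst; infer_instance

/-- The mixture `∑_{k ≥ 0} (1 - a) a^k (π^1 * ⋯ * π^k)`, as a measure. -/
noncomputable def geomMixtureMeasure (a : Set.Ioo (0 : ℝ) 1) (π : ℕ → ProbabilityMeasure ℝ≥0) :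
    Measure ℝ≥0 :=
  Measure.sum fun k : ℕ => ENNReal.ofReal ((1 - (a : ℝ)) * (a : ℝ) ^ k) • convFirst π k

instance isProbabilityMeasure_geomMixtureMeasure (a : Set.Ioo (0 : ℝ) 1)
    (π : ℕ → ProbabilityMeasure ℝ≥0) : IsProbabilityMeasure (geomMixtureMeasure a π) := by
  obtain ⟨a, h0, h1⟩ := a
  have hs : HasSum (fun k : ℕ => (1 - a) * a ^ k) 1 := by
    have h := (hasSum_geometric_of_lt_one h0.le h1).mul_left (1 - a)
    rwa [mul_inv_cancel₀ (sub_pos.2 h1).ne'] at h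
  constructor
  have hn : ∀ k : ℕ, 0 ≤ (1 - a) * a ^ k := fun k =>
    mul_nonneg (sub_pos.2 h1).le (pow_nonneg h0.le k)
  simp only [geomMixtureMeasure, Measure.sum_apply _ MeasurableSet.univ, Measure.smul_apply,
    measure_univ, smul_eq_mul, mul_one]
  rw [← ENNReal.ofReal_tsum_of_nonneg hn hs.summable, hs.tsum_eq, ENNReal.ofReal_one]

/-- The probability measure `∑_{k ≥ 0} (1 - a) a^k (π^1 * ⋯ * π^k)` on `[0,∞)`. -/
noncomputable def geomMixture (a : Set.Ioo (0 : ℝ) 1) (π : ℕ → ProbabilityMeasure ℝ≥0) :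
    ProbabilityMeasure ℝ≥0 :=
  ⟨geomMixtureMeasure a π, inferInstance⟩

/-- `W¹_{[0,T]}(ν₁, ν₂) = ∫_0^T |ν₁([0,t]) - ν₂([0,t])| dt`. -/
noncomputable def wassersteinUpTo (T : ℝ≥0) (ν₁ ν₂ : ProbabilityMeasure ℝ≥0) : ℝ :=
  ∫ t in (0 : ℝ)..T, |(ν₁ : Measure ℝ≥0).real (Set.Icc 0 t.toNNReal)
    - (ν₂ : Measure ℝ≥0).real (Set.Icc 0 t.toNNReal)|

/-- The array `(π^m_n)` is null: `lim_n sup_m π^m_n([ε,∞)) = 0` for all `ε > 0`. -/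
def IsNullArray (π : ℕ → ℕ → ProbabilityMeasure ℝ≥0) : Prop :=
  ∀ ε : ℝ≥0, 0 < ε →
    Tendsto (fun n => ⨆ m, (π n m : Measure ℝ≥0) (Set.Ici ε)) atTop (𝓝 0)

/-- The hypotheses which the convergence theorem for nonhomogeneous Hawkes processes imposes on the
scaling sequence `a` and on the array of kernels. In the code `π n m` stands for `π^{m+1}_n`. The
only other hypothesis of that theorem, the vague convergence of `(1 - a_n) μ_n`, concerns the
background intensities `μ_n` and does not involve the array. -/
structure ArrayConditions (a : ℕ → Set.Ioo (0 : ℝ) 1) (π : ℕ → ℕ → ProbabilityMeasure ℝ≥0) :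
    Prop where
  /-- the kernels are carried by `(0,∞)` -/
  apply_zero : ∀ n m, (π n m : Measure ℝ≥0) {0} = 0
  null : IsNullArray π
  /-- weak convergence to a probability measure without atom at `0` -/
  tendsto_mixture : ∃ ρ : ProbabilityMeasure ℝ≥0, (ρ : Measure ℝ≥0) {0} = 0 ∧
    Tendsto (fun n => geomMixture (a n) (π n)) atTop (𝓝 ρ)
  /-- periodicity in the generation, or closeness to the first generation -/
  periodic_or_close :
    (∃ d : ℕ, 1 ≤ d ∧ ∀ n m, π n (m + d) = π n m) ∨
    (∀ T : ℝ≥0, Tendsto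
      (fun n => ((1 - (a n : ℝ)) ^ 2)⁻¹ * ⨆ m, wassersteinUpTo T (π n m) (π n 0)) atTop (𝓝 0))

/-!
Write `p = 1 - a`. Geometric infinite divisibility of `ρ` gives a law `π` with
`ρ = ∑_{k ≥ 1} p (1 - p)^(k-1) π^{*k}`. The term `k = 1` shows `p π ≤ ρ`; hence `π` is carried by
`[0,∞)` (`IsGeomInfDivisible.exists_apply_eq_tsum`) and has no atom at `0`
(`apply_eq_zero_of_tsum`). The same `π`, used as kernel in the mixture that starts at `k = 0`,
gives `∑_{k ≥ 0} (1 - a) a^k π^{*k} = (1 - a) δ₀ + a ρ` (`geomMixtureMeasure_const_eq`), which tends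
to `ρ` as `a → 1`.

The kernels form a null array because of the Laplace transform at `1`: with `L` and `R` the values
for `π` and `ρ`, the last identity reads `(1 - a) / (1 - a L) = (1 - a) + a R`, so that
`1 - L ≤ 1 - a L ≤ (1 - a) / (a R) → 0`, and `1 - L` controls `π([ε,∞))` by Markov's inequality
(`kernel_Ici_mul_le`). A row-constant array has period `1`.
-/

/-! ### Laws of deterministic and random sums -/

/-- The law of a sum of `k` iid random variables is the `k`-fold convolution of their law. -/
theorem convFirst_const_eq_map_sum {Ω : Type*} [MeasurableSpace Ω] {P : Measure Ω}
    [IsProbabilityMeasure P] {Y : ℕ → Ω → ℝ≥0} (hY : ∀ m, Measurable (Y m)) (hind : iIndepFun Y P)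
    (π : ProbabilityMeasure ℝ≥0) (hπ : ∀ m, P.map (Y m) = (π : Measure ℝ≥0)) (k : ℕ) :
    convFirst (fun _ => π) k = P.map (fun ω => ∑ m ∈ Finset.range k, Y m ω) := by
  induction k with
  | zero => simp [convFirst, Measure.map_const]
  | succ k ih =>
    have hsum : Measurable fun ω => ∑ m ∈ Finset.range k, Y m ω :=
      Finset.measurable_fun_sum _ fun m _ => hY m
    have hi : IndepFun (fun ω => ∑ m ∈ Finset.range k, Y m ω) (Y k) P := by
      have h := hind.indepFun_finsetSum_of_notMem hY (s := Finset.range k) (i := k) (by simp)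
      convert h using 1
      ext ω
      simp
    rw [convFirst, ih, ← hπ k, ← hi.map_add_eq_map_conv_map hsum (hY k)]
    congr 1
    ext ω
    simp [Finset.sum_range_succ]

/-- The law of the sum of a random number `G` of terms of an iid sequence, for `G` independent of
the sequence, is the mixture of the convolution powers with weights `P(G = k)`. -/
theorem map_randomSum_apply {Ω : Type*} [MeasurableSpace Ω] {P : Measure Ω}
    [IsProbabilityMeasure P] {Y : ℕ → Ω → ℝ≥0} {G : Ω → ℕ} (hY : ∀ m, Measurable (Y m))
    (hG : Measurable G) (hind : iIndepFun Y P) (hGY : IndepFun G (fun ω m => Y m ω) P)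
    (π : ProbabilityMeasure ℝ≥0) (hπ : ∀ m, P.map (Y m) = (π : Measure ℝ≥0))
    {A : Set ℝ≥0} (hA : MeasurableSet A) :
    P ((fun ω => ∑ m ∈ Finset.range (G ω), Y m ω) ⁻¹' A)
      = ∑' k, P (G ⁻¹' {k}) * convFirst (fun _ => π) k A := by
  have hsum : ∀ k, Measurable fun ω => ∑ m ∈ Finset.range k, Y m ω := fun k =>
    Finset.measurable_fun_sum _ fun m _ => hY m
  have hU : (fun ω => ∑ m ∈ Finset.range (G ω), Y m ω) ⁻¹' A
      = ⋃ k, G ⁻¹' {k} ∩ (fun ω => ∑ m ∈ Finset.range k, Y m ω) ⁻¹' A := by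
    ext ω
    simp
  rw [hU, measure_iUnion]
  · refine tsum_congr fun k => ?_
    have hφ : Measurable fun y : ℕ → ℝ≥0 => ∑ m ∈ Finset.range k, y m :=
      Finset.measurable_fun_sum _ fun m _ => measurable_pi_apply m
    have hi : IndepFun G (fun ω => ∑ m ∈ Finset.range k, Y m ω) P :=
      hGY.comp measurable_id hφ
    rw [hi.measure_inter_preimage_eq_mul _ _ (measurableSet_singleton k) hA,
      convFirst_const_eq_map_sum hY hind π hπ, Measure.map_apply (hsum k) hA]
  · intro i j hij
    refine Disjoint.mono Set.inter_subset_left Set.inter_subset_left ?_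
    exact Disjoint.preimage G (by simpa using hij)
  · exact fun k => (hG (measurableSet_singleton k)).inter (hsum k hA)

/-! ### Kernels from geometric infinite divisibility -/

/-- A geometrically infinitely divisible law on `[0,∞)` is a geometric mixture, over `k ≥ 1`, of
the convolution powers of a law that is itself carried by `[0,∞)`. -/
theorem IsGeomInfDivisible.exists_apply_eq_tsum {ρ : ProbabilityMeasure ℝ≥0}
    (hρ : IsGeomInfDivisible ((ρ : Measure ℝ≥0).map (fun x : ℝ≥0 => (x : ℝ))))
    (a : Set.Ioo (0 : ℝ) 1) :
    ∃ π : ProbabilityMeasure ℝ≥0, ∀ A : Set ℝ≥0, MeasurableSet A →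
      (ρ : Measure ℝ≥0) A = ∑' k : ℕ, ENNReal.ofReal ((1 - (a : ℝ)) * (a : ℝ) ^ k)
        * convFirst (fun _ => π) (k + 1) A := by
  obtain ⟨a, h0, h1⟩ := a
  obtain ⟨Ω, _, P, X, G, _, hX, hG, hind, hid, hGP, hGX, hlaw⟩ :=
    hρ (1 - a) ⟨by linarith, by linarith⟩
  simp only [sub_sub_cancel] at hGP
  have hSm : Measurable fun ω => ∑ m ∈ Finset.range (G ω), X m ω := by
    have h : Measurable fun q : ℕ × Ω => ∑ m ∈ Finset.range q.1, X m q.2 :=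
      measurable_from_prod_countable_right fun k =>
        Finset.measurable_fun_sum (Finset.range k) fun m _ => hX m
    exact h.comp (hG.prodMk measurable_id)
  -- On `{G = 1}` the random sum is `X 0`, so a negative part of `X 0` would be seen by `ρ`.
  have hneg0 : P (X 0 ⁻¹' Set.Iio 0) = 0 := by
    have hi := (hGX.comp measurable_id (measurable_pi_apply 0)).measure_inter_preimage_eq_mul
      {1} (Set.Iio 0) (measurableSet_singleton 1) measurableSet_Iio
    have hS : P ((fun ω => ∑ m ∈ Finset.range (G ω), X m ω) ⁻¹' Set.Iio 0) = 0 := by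
      rw [← Measure.map_apply hSm measurableSet_Iio, hlaw,
        Measure.map_apply (by fun_prop) measurableSet_Iio]
      convert measure_empty (μ := (ρ : Measure ℝ≥0))
      ext x
      simp
    have hz : P (G ⁻¹' {1} ∩ X 0 ⁻¹' Set.Iio 0) = 0 := by
      refine measure_mono_null ?_ hS
      rintro ω ⟨hω, hω'⟩
      have hω : G ω = 1 := hω
      simpa [hω] using hω'
    have hi' : P (G ⁻¹' {1} ∩ X 0 ⁻¹' Set.Iio 0) = P (G ⁻¹' {1}) * P (X 0 ⁻¹' Set.Iio 0) := hi
    rw [hz, hGP 0] at hi'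
    refine (mul_eq_zero.1 hi'.symm).resolve_left ?_
    simp [h1]
  have hnn : ∀ᵐ ω ∂P, ∀ m, 0 ≤ X m ω := by
    refine ae_all_iff.2 fun m => ?_
    have h := (hid m).measure_mem_eq (measurableSet_Iio (a := (0 : ℝ)))
    rw [hneg0] at h
    rw [ae_iff]
    convert h using 2
    ext ω
    simp
  let Y : ℕ → Ω → ℝ≥0 := fun m ω => (X m ω).toNNReal
  have hY : ∀ m, Measurable (Y m) := fun m => (hX m).real_toNNReal
  have hYind : iIndepFun Y P := hind.comp (fun _ => Real.toNNReal) fun _ => measurable_real_toNNReal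
  have hGY : IndepFun G (fun ω m => Y m ω) P :=
    hGX.comp measurable_id
      (measurable_pi_lambda _ fun m => (measurable_pi_apply m).real_toNNReal :
        Measurable fun (x : ℕ → ℝ) m => (x m).toNNReal)
  let π : ProbabilityMeasure ℝ≥0 :=
    ⟨P.map (Y 0), Measure.isProbabilityMeasure_map (hY 0).aemeasurable⟩
  have hπ : ∀ m, P.map (Y m) = (π : Measure ℝ≥0) := fun m =>
    ((hid m).comp measurable_real_toNNReal).map_eq
  -- The probabilities `P(G = k)`, `k ≥ 1`, already add up to one.
  have hG0 : P (G ⁻¹' {0}) = 0 := by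
    have hs : HasSum (fun k : ℕ => (1 - a) * a ^ k) 1 := by
      have h := (hasSum_geometric_of_lt_one h0.le h1).mul_left (1 - a)
      rwa [mul_inv_cancel₀ (sub_pos.2 h1).ne'] at h
    have hn : ∀ k : ℕ, 0 ≤ (1 - a) * a ^ k := fun k =>
      mul_nonneg (sub_pos.2 h1).le (pow_nonneg h0.le k)
    have htot : ∑' k, P (G ⁻¹' {k}) = 1 := by
      rw [← measure_iUnion (fun i j hij => Disjoint.preimage G (by simpa using hij))
        fun k => hG (measurableSet_singleton k), ← Set.preimage_iUnion,
        Set.iUnion_of_singleton, Set.preimage_univ, measure_univ]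
    rw [tsum_eq_zero_add' ENNReal.summable] at htot
    simp only [hGP] at htot
    rw [← ENNReal.ofReal_tsum_of_nonneg hn hs.summable, hs.tsum_eq, ENNReal.ofReal_one] at htot
    simpa using htot
  refine ⟨π, fun A hA => ?_⟩
  have hcoe : (ρ : Measure ℝ≥0) A = P ((fun ω => ∑ m ∈ Finset.range (G ω), Y m ω) ⁻¹' A) := by
    have hA' : MeasurableSet (Real.toNNReal ⁻¹' A) := measurable_real_toNNReal hA
    have h := congrArg (fun μ => μ (Real.toNNReal ⁻¹' A)) hlaw
    simp only [Measure.map_apply hSm hA', Measure.map_apply measurable_coe_nnreal_real hA'] at h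
    have h' : (fun x : ℝ≥0 => (x : ℝ)) ⁻¹' (Real.toNNReal ⁻¹' A) = A := by
      ext x
      simp
    rw [h'] at h
    rw [← h]
    refine measure_congr ?_
    filter_upwards [hnn] with ω hω
    change (_ ∈ A) = (_ ∈ A)
    rw [Real.toNNReal_sum_of_nonneg fun m _ => hω m]
  rw [hcoe, map_randomSum_apply hY hG hYind hGY π hπ hA, tsum_eq_zero_add' ENNReal.summable, hG0,
    zero_mul, zero_add]
  simp only [hGP]

/-- If `ρ` is the geometric mixture of the convolution powers `π^{*k}` over `k ≥ 1`, then including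
the term `k = 0` and shifting the weights turns it into `(1 - a) δ₀ + a ρ`. -/
theorem geomMixtureMeasure_const_eq {ρ π : ProbabilityMeasure ℝ≥0} {a : Set.Ioo (0 : ℝ) 1}
    (h : ∀ A : Set ℝ≥0, MeasurableSet A →
      (ρ : Measure ℝ≥0) A = ∑' k : ℕ, ENNReal.ofReal ((1 - (a : ℝ)) * (a : ℝ) ^ k)
        * convFirst (fun _ => π) (k + 1) A) :
    geomMixtureMeasure a (fun _ => π)
      = ENNReal.ofReal (1 - (a : ℝ)) • Measure.dirac 0
        + ENNReal.ofReal (a : ℝ) • (ρ : Measure ℝ≥0) := by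
  have ha0 : 0 ≤ (a : ℝ) := a.2.1.le
  ext A hA
  simp only [geomMixtureMeasure, Measure.sum_apply _ hA, Measure.add_apply, Measure.smul_apply,
    smul_eq_mul]
  rw [tsum_eq_zero_add' ENNReal.summable, h A hA, ← ENNReal.tsum_mul_left]
  congr 1
  · simp [convFirst]
  · refine tsum_congr fun k => ?_
    rw [← mul_assoc, ← ENNReal.ofReal_mul ha0]
    ring_nf

/-- The term `k = 0` of the mixture is a positive multiple of `π`, so `π` is absolutely continuous
with respect to `ρ`. -/
theorem apply_eq_zero_of_tsum {ρ π : ProbabilityMeasure ℝ≥0} {a : Set.Ioo (0 : ℝ) 1}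
    (h : ∀ A : Set ℝ≥0, MeasurableSet A →
      (ρ : Measure ℝ≥0) A = ∑' k : ℕ, ENNReal.ofReal ((1 - (a : ℝ)) * (a : ℝ) ^ k)
        * convFirst (fun _ => π) (k + 1) A)
    {A : Set ℝ≥0} (hA : MeasurableSet A) (hρA : (ρ : Measure ℝ≥0) A = 0) :
    (π : Measure ℝ≥0) A = 0 := by
  have h0 := ENNReal.tsum_eq_zero.1 ((h A hA).symm.trans hρA) 0
  have hc : convFirst (fun _ => π) (0 + 1) = (π : Measure ℝ≥0) := by
    simp [convFirst]
  rw [hc] at h0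
  refine (mul_eq_zero.1 h0).resolve_left ?_
  simpa using a.2.2

/-! ### Laplace transforms and null arrays -/

/-- The Laplace transform at `1` of a convolution power. -/
theorem lintegral_exp_neg_convFirst_const (π : ProbabilityMeasure ℝ≥0) (k : ℕ) :
    ∫⁻ x, ENNReal.ofReal (Real.exp (-(x : ℝ))) ∂(convFirst (fun _ => π) k)
      = (∫⁻ x, ENNReal.ofReal (Real.exp (-(x : ℝ))) ∂(π : Measure ℝ≥0)) ^ k := by
  have hm : Measurable fun x : ℝ≥0 => ENNReal.ofReal (Real.exp (-(x : ℝ))) := by fun_prop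
  induction k with
  | zero => simp [convFirst]
  | succ k ih =>
    rw [convFirst, Measure.lintegral_conv hm]
    simp only [NNReal.coe_add, neg_add, Real.exp_add, ENNReal.ofReal_mul (Real.exp_pos _).le]
    simp_rw [lintegral_const_mul _ hm]
    rw [lintegral_mul_const _ hm, ih, pow_succ]

/-- The Laplace transform at `1` of a geometric mixture with constant kernel. -/
theorem lintegral_exp_neg_geomMixtureMeasure_const (a : Set.Ioo (0 : ℝ) 1)
    (π : ProbabilityMeasure ℝ≥0) :
    ∫⁻ x, ENNReal.ofReal (Real.exp (-(x : ℝ))) ∂(geomMixtureMeasure a fun _ => π)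
      = ENNReal.ofReal (1 - (a : ℝ)) * (1 - ENNReal.ofReal (a : ℝ)
        * ∫⁻ x, ENNReal.ofReal (Real.exp (-(x : ℝ))) ∂(π : Measure ℝ≥0))⁻¹ := by
  have h1 : 0 ≤ 1 - (a : ℝ) := (sub_pos.2 a.2.2).le
  rw [geomMixtureMeasure, lintegral_sum_measure, ← ENNReal.tsum_geometric, ← ENNReal.tsum_mul_left]
  refine tsum_congr fun k => ?_
  rw [lintegral_smul_measure, lintegral_exp_neg_convFirst_const, ENNReal.ofReal_mul h1,
    ENNReal.ofReal_pow a.2.1.le, smul_eq_mul, mul_pow, mul_assoc]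

/-- Quantitative smallness of the kernel: Markov's inequality for `1 - e^{-x}`, combined with the
Laplace transforms of both sides of `∑ (1 - a) a^k π^{*k} = (1 - a) δ₀ + a ρ`. -/
theorem kernel_Ici_mul_le {ρ π : ProbabilityMeasure ℝ≥0} {a : Set.Ioo (0 : ℝ) 1}
    (h : geomMixtureMeasure a (fun _ => π)
      = ENNReal.ofReal (1 - (a : ℝ)) • Measure.dirac 0
        + ENNReal.ofReal (a : ℝ) • (ρ : Measure ℝ≥0)) (ε : ℝ≥0) :
    ENNReal.ofReal (1 - Real.exp (-(ε : ℝ))) * (π : Measure ℝ≥0) (Set.Ici ε)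
      ≤ ENNReal.ofReal (1 - (a : ℝ)) / (ENNReal.ofReal (a : ℝ)
        * ∫⁻ x, ENNReal.ofReal (Real.exp (-(x : ℝ))) ∂(ρ : Measure ℝ≥0)) := by
  have hm : Measurable fun x : ℝ≥0 => ENNReal.ofReal (Real.exp (-(x : ℝ))) := by fun_prop
  have hm' : Measurable fun x : ℝ≥0 => ENNReal.ofReal (1 - Real.exp (-(x : ℝ))) := by fun_prop
  have hlap := lintegral_exp_neg_geomMixtureMeasure_const a π
  rw [h, lintegral_add_measure, lintegral_smul_measure, lintegral_smul_measure] at hlap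
  set R := ∫⁻ x, ENNReal.ofReal (Real.exp (-(x : ℝ))) ∂(ρ : Measure ℝ≥0)
  set L := ∫⁻ x, ENNReal.ofReal (Real.exp (-(x : ℝ))) ∂(π : Measure ℝ≥0) with hL
  have hLadd : (∫⁻ x, ENNReal.ofReal (1 - Real.exp (-(x : ℝ))) ∂(π : Measure ℝ≥0)) + L = 1 := by
    rw [hL, ← lintegral_add_left hm']
    have : ∀ x : ℝ≥0, ENNReal.ofReal (1 - Real.exp (-(x : ℝ)))
        + ENNReal.ofReal (Real.exp (-(x : ℝ))) = 1 := fun x => by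
      rw [← ENNReal.ofReal_add (by simp) (Real.exp_pos _).le]
      simp
    simp [this]
  have hL1 : L ≤ 1 := hLadd ▸ le_add_self
  have hmarkov : ENNReal.ofReal (1 - Real.exp (-(ε : ℝ))) * (π : Measure ℝ≥0) (Set.Ici ε)
      ≤ ∫⁻ x, ENNReal.ofReal (1 - Real.exp (-(x : ℝ))) ∂(π : Measure ℝ≥0) := by
    refine le_trans (mul_le_mul_right (measure_mono ?_) _) (mul_meas_ge_le_lintegral hm' _)
    intro x hx
    have hx' : (ε : ℝ) ≤ x := NNReal.coe_le_coe.2 hx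
    exact ENNReal.ofReal_le_ofReal (by gcongr)
  have hone : ∫⁻ x, ENNReal.ofReal (1 - Real.exp (-(x : ℝ))) ∂(π : Measure ℝ≥0)
      ≤ 1 - ENNReal.ofReal (a : ℝ) * L := by
    refine ENNReal.le_sub_of_add_le_right ?_ ?_
    · exact ENNReal.mul_ne_top ENNReal.ofReal_ne_top (hL1.trans_lt ENNReal.one_lt_top).ne
    · calc _ ≤ (∫⁻ x, ENNReal.ofReal (1 - Real.exp (-(x : ℝ))) ∂(π : Measure ℝ≥0)) + L := by
            gcongr
            exact mul_le_of_le_one_left' (by simpa using a.2.2.le)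
        _ = 1 := hLadd
  refine (hmarkov.trans hone).trans ?_
  have hle : ENNReal.ofReal (a : ℝ) * R
      ≤ ENNReal.ofReal (1 - (a : ℝ)) * (1 - ENNReal.ofReal (a : ℝ) * L)⁻¹ := by
    rw [← hlap]
    exact le_add_self
  have ha : 0 < 1 - (a : ℝ) := sub_pos.2 a.2.2
  have hD0 : 1 - ENNReal.ofReal (a : ℝ) * L ≠ 0 := by
    refine (tsub_pos_of_lt ?_).ne'
    calc ENNReal.ofReal (a : ℝ) * L ≤ ENNReal.ofReal (a : ℝ) := mul_le_of_le_one_right' hL1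
      _ < 1 := by simpa using a.2.2
  have hDt : 1 - ENNReal.ofReal (a : ℝ) * L ≠ ∞ := ENNReal.sub_ne_top ENNReal.one_ne_top
  rw [ENNReal.le_div_iff_mul_le (Or.inr (by simpa using a.2.2))
    (Or.inr ENNReal.ofReal_ne_top)]
  calc (1 - ENNReal.ofReal (a : ℝ) * L) * (ENNReal.ofReal (a : ℝ) * R)
      ≤ (1 - ENNReal.ofReal (a : ℝ) * L)
        * (ENNReal.ofReal (1 - (a : ℝ)) * (1 - ENNReal.ofReal (a : ℝ) * L)⁻¹) := by gcongr
    _ = ENNReal.ofReal (1 - (a : ℝ)) := by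
      rw [mul_left_comm, ENNReal.mul_inv_cancel hD0 hDt, mul_one]

theorem tendsto_kernel_Ici {ρ : ProbabilityMeasure ℝ≥0} {π : ℕ → ProbabilityMeasure ℝ≥0}
    {a : ℕ → Set.Ioo (0 : ℝ) 1} (ha : Tendsto (fun n => (a n : ℝ)) atTop (𝓝 1))
    (h : ∀ n, geomMixtureMeasure (a n) (fun _ => π n)
      = ENNReal.ofReal (1 - (a n : ℝ)) • Measure.dirac 0
        + ENNReal.ofReal (a n : ℝ) • (ρ : Measure ℝ≥0)) {ε : ℝ≥0} (hε : 0 < ε) :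
    Tendsto (fun n => (π n : Measure ℝ≥0) (Set.Ici ε)) atTop (𝓝 0) := by
  have hm : Measurable fun x : ℝ≥0 => ENNReal.ofReal (Real.exp (-(x : ℝ))) := by fun_prop
  set R := ∫⁻ x, ENNReal.ofReal (Real.exp (-(x : ℝ))) ∂(ρ : Measure ℝ≥0) with hR
  have hR0 : R ≠ 0 := by
    rw [hR, Ne, lintegral_eq_zero_iff hm]
    intro h0
    obtain ⟨x, hx⟩ := h0.exists
    exact (ENNReal.ofReal_pos.2 (Real.exp_pos _)).ne' hx
  have hc0 : ENNReal.ofReal (1 - Real.exp (-(ε : ℝ))) ≠ 0 := by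
    simpa using hε
  have hp : Tendsto (fun n => ENNReal.ofReal (1 - (a n : ℝ))) atTop (𝓝 0) := by
    simpa using ENNReal.tendsto_ofReal (ha.const_sub 1)
  have hq : Tendsto (fun n => ENNReal.ofReal (a n : ℝ) * R) atTop (𝓝 R) := by
    simpa using ENNReal.Tendsto.mul_const (ENNReal.tendsto_ofReal ha) (b := R) (Or.inl (by simp))
  have hlim : Tendsto (fun n => ENNReal.ofReal (1 - (a n : ℝ)) / (ENNReal.ofReal (a n : ℝ) * R)
      / ENNReal.ofReal (1 - Real.exp (-(ε : ℝ)))) atTop (𝓝 0) := by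
    have h1 := ENNReal.Tendsto.div hp (Or.inr hR0) hq (Or.inr ENNReal.zero_ne_top)
    have h2 := ENNReal.Tendsto.div_const h1
      (b := ENNReal.ofReal (1 - Real.exp (-(ε : ℝ)))) (Or.inr hc0)
    simpa using h2
  refine tendsto_of_tendsto_of_tendsto_of_le_of_le tendsto_const_nhds hlim (fun _ => zero_le)
    fun n => ?_
  rw [ENNReal.le_div_iff_mul_le (Or.inl hc0) (Or.inl ENNReal.ofReal_ne_top), mul_comm]
  exact kernel_Ici_mul_le (h n) ε

/-! ### Weak convergence of the mixtures -/

theorem tendsto_geomMixture_const {ρ : ProbabilityMeasure ℝ≥0} {π : ℕ → ProbabilityMeasure ℝ≥0}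
    {a : ℕ → Set.Ioo (0 : ℝ) 1} (ha : Tendsto (fun n => (a n : ℝ)) atTop (𝓝 1))
    (h : ∀ n, geomMixtureMeasure (a n) (fun _ => π n)
      = ENNReal.ofReal (1 - (a n : ℝ)) • Measure.dirac 0
        + ENNReal.ofReal (a n : ℝ) • (ρ : Measure ℝ≥0)) :
    Tendsto (fun n => geomMixture (a n) (fun _ => π n)) atTop (𝓝 ρ) := by
  rw [ProbabilityMeasure.tendsto_iff_forall_integral_tendsto]
  intro f
  have hint : ∀ n, ∫ x, f x ∂(geomMixture (a n) (fun _ => π n) : Measure ℝ≥0)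
      = (1 - (a n : ℝ)) * f 0 + (a n : ℝ) * ∫ x, f x ∂(ρ : Measure ℝ≥0) := fun n => by
    change ∫ x, f x ∂(geomMixtureMeasure (a n) (fun _ => π n)) = _
    rw [h n, integral_add_measure ((f.integrable _).smul_measure ENNReal.ofReal_ne_top)
      ((f.integrable _).smul_measure ENNReal.ofReal_ne_top), integral_smul_measure,
      integral_smul_measure, integral_dirac, ENNReal.toReal_ofReal (sub_pos.2 (a n).2.2).le,
      ENNReal.toReal_ofReal (a n).2.1.le, smul_eq_mul, smul_eq_mul]
  simp only [hint]
  simpa using ((ha.const_sub 1).mul_const (f 0)).add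
    (ha.mul_const (∫ x, f x ∂(ρ : Measure ℝ≥0)))

theorem proposition4p2 (ρ : ProbabilityMeasure ℝ≥0)
    (hρ : IsGeomInfDivisible ((ρ : Measure ℝ≥0).map (fun x : ℝ≥0 => (x : ℝ))))
    (hρ0 : (ρ : Measure ℝ≥0) {0} = 0)
    (a : ℕ → Set.Ioo (0 : ℝ) 1) (ha : Tendsto (fun n => (a n : ℝ)) atTop (𝓝 1)) :
    ∃ π : ℕ → ProbabilityMeasure ℝ≥0,
      ArrayConditions a (fun n _ => π n) ∧
      Tendsto (fun n => geomMixture (a n) (fun _ => π n)) atTop (𝓝 ρ) := by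
  choose π hπ using fun n => hρ.exists_apply_eq_tsum (a n)
  have hmix := fun n => geomMixtureMeasure_const_eq (hπ n)
  have hlim := tendsto_geomMixture_const ha hmix
  refine ⟨π, ⟨fun n _ => apply_eq_zero_of_tsum (hπ n) (measurableSet_singleton 0) hρ0, ?_,
    ⟨ρ, hρ0, hlim⟩, Or.inl ⟨1, le_rfl, fun _ _ => rfl⟩⟩, hlim⟩
  intro ε hε
  simpa only [ciSup_const] using tendsto_kernel_Ici ha hmix hε
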